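/- Fix a relational signature $\mathcal S$ whose relations have positive arity, a side signature $\mathcal S'\subseteq\mathcal S$, and an infinite set of values. A fact $R(\vec a)$ over these values is a \emph{side} fact if $R\in\mathcal S'$ and a \emph{principal} fact otherwise, and likewise for atoms. A \emph{GTGD} is a single-headed constant-free dependency $\forall\vec x\,(\beta(\vec x)\to\exists\vec y\,A(\vec x,\vec y))$ such that some body atom (a \emph{guard}) contains all variables of the body $\beta$; a head variable that does not occur in $\beta$ is existentially quantified. It is \emph{full} if it has no existential variable, it is a \emph{side} (resp. \emph{principal}) GTGD if its head $A$ is a side (resp. principal) atom, and it \emph{obeys} $\mathcal S'$ if for some choice of guard all other body atoms are side atoms. A \emph{trigger} of the GTGD in a set of facts $J$ is a substitution $\tau$ with $\tau(\beta)\subseteq J$. A set of facts is \emph{guarded} by another one if it only uses values occurring in the latter. For a finite instance $I_0$, a finite set $\Sigma$ of GTGDs and a fact $F$, write $I_0,\Sigma\models F$ if $F$ belongs to every (finite or infinite) superinstance of $I_0$ that satisfies $\Sigma$. A \emph{chase tree} is a rooted tree $T$ with a finite set of facts $T(v)$ for each node $v$ and with one node marked as recently updated. A \emph{principal-exempt one-pass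 chase} for $I_0$ and $\Sigma$ is a finite sequence $T_0,\dots,T_n$ of chase trees such that $T_0$ consists only of a root $r$, which is recently updated, with $T_0(r)=I_0$, and each $T_{i+1}$ is obtained from $T_i$ by one of the following steps on the recently updated node $v$ of $T_i$: \begin{enumerate} \item (propagation) copy exactly one side fact of $v$ to the parent $p$ of $v$, where this fact does not occur in $T_i(p)$ and is guarded by $T_i(p)$; then $p$ is recently updated; \item (full side step) for a full side GTGD of $\Sigma$ with head $A$ and a trigger $\tau$ in $T_i(v)$ such that $\tau(A)$ occurs in no node of $T_i$, add $\tau(A)$ to $v$; then $v$ is recently updated; \item (non-full step) for a non-full GTGD of $\Sigma$ with head $A$ and a trigger $\tau$ in $T_i(v)$, extend $\tau$ to $\tau'$ by mapping the existential variables to distinct values that do not occur in $T_i$, and create a new child of $v$ that contains $\tau'(A)$ together with some (inherited) side facts of $T_i(v)$ guarded by $\tau'(A)$; then the child is recently updated; \item (relaxed step) for a full principal GTGD of $\Sigma$ with head $A$ and a trigger $\tau$ in $T_i(v)$, create a new child of $v$ that contains $\tau(A)$ together with some (inherited) side facts of $T_i(v)$ guarded by $\tau(A)$; then the child is recently updated;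 \end{enumerate} where steps 2--4 are allowed only if no step 1 applies to $T_i$. It is a \emph{principal-exempt one-pass tree-like chase proof of $F$} if $F\in T_n(v)$ for some node $v$ of $T_n$. \textbf{Theorem.} For each finite instance $I_0$, each finite set $\Sigma$ of GTGDs obeying the side signature $\mathcal S'$, and each fact $F$ such that $I_0,\Sigma\models F$, there exists a principal-exempt one-pass tree-like chase proof of $F$ from $I_0$ and $\Sigma$. -/

import Mathlib

namespace GTGDChase

universe u v w

/-! ## Relational signatures, atoms, instances -/

/-- A relational signature: a type of relations, each with a positive arity. -/
structure RelSignature where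
  Rel : Type u
  arity : Rel → ℕ
  arity_pos : ∀ R, 0 < arity R

/-- An atom `R(t₁, …, tₙ)` whose terms are elements of `T`. If `T` is a type of variables this is an
atom of a dependency; if `T` is a type of domain elements (values) this is a fact. -/
structure RelAtom (S : RelSignature.{u}) (T : Type v) where
  rel : S.Rel
  args : Fin (S.arity rel) → T

/-- A fact (ground atom) over the domain `V`. -/
abbrev GroundFact (S : RelSignature.{u}) (V : Type w) := RelAtom S V

/-- A (finite or infinite) instance, seen as a set of facts. -/
abbrev RelInstance (S : RelSignature.{u}) (V : Type w) := Set (GroundFact S V)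

namespace RelAtom

variable {S : RelSignature.{u}} {T : Type v} {T' : Type w}

/-- The set of terms occurring in an atom; for a fact, its active domain. -/
def terms (A : RelAtom S T) : Set T := Set.range A.args

/-- Apply a substitution to all terms of an atom. -/
def subst (f : T → T') (A : RelAtom S T) : RelAtom S T' where
  rel := A.rel
  args := fun i => f (A.args i)

/-- With respect to a side signature (a set of relations), an atom is a side atom if its relation
belongs to the side signature; otherwise it is a principal atom. -/
def IsSide (side : Set S.Rel) (A : RelAtom S T) : Prop := A.rel ∈ side

/-- An atom whose relation is not in the side signature. -/
def IsPrincipal (side : Set S.Rel) (A : RelAtom S T) : Prop := A.rel ∉ side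

end RelAtom

/-- The active domain of a set of facts: the values that occur in it. -/
def adom {S : RelSignature.{u}} {V : Type w} (I : RelInstance S V) : Set V :=
  {a | ∃ F ∈ I, a ∈ F.terms}

/-- A set of facts `J` is guarded by a set of facts `I` if the facts of `J` only use values
occurring in `I`. -/
def GuardedBy {S : RelSignature.{u}} {V : Type w} (J I : RelInstance S V) : Prop :=
  adom J ⊆ adom I

/-! ## Tuple-generating dependencies -/

/-- A single-headed TGD `∀ x⃗, β(x⃗) → ∃ y⃗, A(x⃗, y⃗)` over the variables `X`, given by its body `β`
(a finite conjunction of atoms) and its head atom `A`. The variables of the head that do not occur in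
the body are the existentially quantified ones; all other variables are universally quantified. -/
structure TGD (S : RelSignature.{u}) (X : Type v) where
  body : Finset (RelAtom S X)
  head : RelAtom S X

namespace TGD

variable {S : RelSignature.{u}} {X : Type v} {V : Type w}

/-- The variables occurring in the body. -/
def bodyVars (γ : TGD S X) : Set X := {x | ∃ A ∈ γ.body, x ∈ A.terms}

/-- The existentially quantified variables of the head. -/
def existVars (γ : TGD S X) : Set X := γ.head.terms \ γ.bodyVars

/-- A TGD is full if it has no existential quantifier in the head. -/
def IsFull (γ : TGD S X) : Prop := γ.existVars = ∅

/-- `A` is a guard of `γ`: an atom of the body which contains all variables of the body. -/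
def IsGuard (γ : TGD S X) (A : RelAtom S X) : Prop := A ∈ γ.body ∧ γ.bodyVars ⊆ A.terms

/-- A guarded TGD (GTGD) is a TGD with a guard. -/
def IsGuarded (γ : TGD S X) : Prop := ∃ A, γ.IsGuard A

/-- `γ` obeys the side signature `side` if, for some choice of guard atom in the body, all other body
atoms are side atoms. -/
def Obeys (γ : TGD S X) (side : Set S.Rel) : Prop :=
  ∃ A, γ.IsGuard A ∧ ∀ B ∈ γ.body, B ≠ A → B.IsSide side

/-- A side TGD: the head atom is a side atom. -/
def IsSideTGD (γ : TGD S X) (side : Set S.Rel) : Prop := γ.head.IsSide side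

/-- A principal TGD: the head atom is a principal atom. -/
def IsPrincipalTGD (γ : TGD S X) (side : Set S.Rel) : Prop := γ.head.IsPrincipal side

/-- `τ` is a trigger of `γ` in `I`: it maps all body atoms to facts of `I`. Only the values of `τ` on
the variables of the body matter. -/
def IsTrigger (γ : TGD S X) (τ : X → V) (I : RelInstance S V) : Prop :=
  ∀ A ∈ γ.body, A.subst τ ∈ I

/-- A trigger is active if no extension of it (to the existentially quantified variables) maps the
head to a fact of `I`. -/
def IsActiveTrigger (γ : TGD S X) (τ : X → V) (I : RelInstance S V) : Prop :=
  γ.IsTrigger τ I ∧ ¬ ∃ τ' : X → V, Set.EqOn τ' τ γ.bodyVars ∧ γ.head.subst τ' ∈ I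

/-- `I ⊨ γ`: there is no active trigger of `γ` in `I`. -/
def SatisfiedBy (γ : TGD S X) (I : RelInstance S V) : Prop :=
  ¬ ∃ τ : X → V, γ.IsActiveTrigger τ I

end TGD

/-- Fact entailment `I₀, Σ ⊨ F`: the fact `F` belongs to every (finite or infinite) superinstance of
`I₀` that satisfies all the dependencies of `Sig`. -/
def EntailsFact {S : RelSignature.{u}} {X : Type v} {V : Type w}
    (I₀ : RelInstance S V) (Sig : Set (TGD S X)) (F : GroundFact S V) : Prop :=
  ∀ J : RelInstance S V, I₀ ⊆ J → (∀ γ ∈ Sig, γ.SatisfiedBy J) → F ∈ J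

/-! ## Chase trees and the steps of the (relaxed) tree-like chase -/

/-- A chase tree: a rooted directed tree, a finite set of facts for each node, and a node marked as
recently updated. Nodes are addresses: the root is `[]`, and the children of a node `p` are
of the form `k :: p`. The values of `facts` outside of `nodes` are irrelevant. -/
structure ChaseTree (S : RelSignature.{u}) (V : Type w) where
  nodes : Set (List ℕ)
  root_mem : [] ∈ nodes
  parent_mem : ∀ k p, k :: p ∈ nodes → p ∈ nodes
  facts : List ℕ → RelInstance S V
  facts_finite : ∀ n ∈ nodes, (facts n).Finite
  recent : List ℕ
  recent_mem : recent ∈ nodes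

namespace ChaseTree

variable {S : RelSignature.{u}} {X : Type v} {V : Type w}

/-- The underlying instance of a chase tree: all facts of all its nodes. -/
def underlying (T : ChaseTree S V) : RelInstance S V := {F | ∃ n ∈ T.nodes, F ∈ T.facts n}

/-- The chase tree with only the root node, which contains the instance `I`. -/
def IsInitial (T : ChaseTree S V) (I : RelInstance S V) : Prop :=
  T.nodes = {[]} ∧ T.recent = [] ∧ T.facts [] = I

/-- Chase step firing the trigger `τ` of the full TGD `γ` on the node `n` of `T`: the derived fact,
which must not occur yet in the tree, is added to `n`. -/
structure FullStep (γ : TGD S X) (τ : X → V) (n : List ℕ) (T T' : ChaseTree S V) : Prop where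
  full : γ.IsFull
  node_mem : n ∈ T.nodes
  trigger : γ.IsTrigger τ (T.facts n)
  fact_new : γ.head.subst τ ∉ T.underlying
  nodes_eq : T'.nodes = T.nodes
  facts_node : T'.facts n = insert (γ.head.subst τ) (T.facts n)
  facts_other : ∀ m ∈ T.nodes, m ≠ n → T'.facts m = T.facts m
  recent_eq : T'.recent = n

/-- `T'` extends `T` with a new child of the node `n`, marked as recently updated, which contains the
fact `G` together with the set `H` of inherited facts, these being facts of `n` guarded by `G`. -/
structure AddsChild (n : List ℕ) (G : GroundFact S V) (H : RelInstance S V)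
    (T T' : ChaseTree S V) : Prop where
  node_mem : n ∈ T.nodes
  inherited : ∀ F ∈ H, F ∈ T.facts n ∧ GuardedBy {F} {G}
  child : ∃ k : ℕ, k :: n ∉ T.nodes ∧ T'.nodes = insert (k :: n) T.nodes ∧
    T'.facts (k :: n) = insert G H ∧ T'.recent = k :: n
  facts_other : ∀ m ∈ T.nodes, T'.facts m = T.facts m

/-- Chase step firing the trigger `τ` of the non-full TGD `γ` on the node `n` of `T`, with
inherited facts `H`: the existentially quantified variables are mapped to distinct values that do not
occur in `T`. -/
def NonFullStep (γ : TGD S X) (τ : X → V) (n : List ℕ) (H : RelInstance S V)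
    (T T' : ChaseTree S V) : Prop :=
  ¬ γ.IsFull ∧ γ.IsTrigger τ (T.facts n) ∧
    ∃ τ' : X → V, Set.EqOn τ' τ γ.bodyVars ∧ Set.InjOn τ' γ.existVars ∧
      (∀ y ∈ γ.existVars, τ' y ∉ adom T.underlying) ∧
      AddsChild n (γ.head.subst τ') H T T'

/-- Relaxed chase step firing the trigger `τ` of the full TGD `γ` on the node `n` of `T`, with
inherited facts `H`: a new child is created for the derived fact. -/
def RelaxedFullStep (γ : TGD S X) (τ : X → V) (n : List ℕ) (H : RelInstance S V)
    (T T' : ChaseTree S V) : Prop :=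
  γ.IsFull ∧ γ.IsTrigger τ (T.facts n) ∧ AddsChild n (γ.head.subst τ) H T T'

/-- Propagation step copying the nonempty set of facts `P` from the node `n` to the node `m`,
where these facts do not occur but are guarded. -/
structure PropagationStep (n m : List ℕ) (P : RelInstance S V) (T T' : ChaseTree S V) : Prop where
  source_mem : n ∈ T.nodes
  target_mem : m ∈ T.nodes
  nonempty : P.Nonempty
  subset : P ⊆ T.facts n
  disjoint : T.facts m ∩ P = ∅
  guarded : GuardedBy P (T.facts m)
  nodes_eq : T'.nodes = T.nodes
  facts_target : T'.facts m = T.facts m ∪ P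
  facts_other : ∀ l ∈ T.nodes, l ≠ m → T'.facts l = T.facts l
  recent_eq : T'.recent = m

/-- One step of the relaxed tree-like chase with the dependencies `Sig`. -/
def RelaxedStep (Sig : Set (TGD S X)) (T T' : ChaseTree S V) : Prop :=
  (∃ γ ∈ Sig, ∃ (τ : X → V) (n : List ℕ),
      FullStep γ τ n T T' ∨ ∃ H, NonFullStep γ τ n H T T' ∨ RelaxedFullStep γ τ n H T T') ∨
  (∃ n m P, PropagationStep n m P T T')

/-- A propagation step copying exactly one side fact from the recently updated node of `T` to its
parent. -/
def SidePropagationStep (side : Set S.Rel) (T T' : ChaseTree S V) : Prop :=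
  ∃ (k : ℕ) (p : List ℕ) (F : GroundFact S V), T.recent = k :: p ∧ F.IsSide side ∧
    PropagationStep (k :: p) p {F} T T'

/-- A chase step of the principal-exempt one-pass chase, on the recently updated node of `T`: a chase
step with a side GTGD or a non-full GTGD, or a relaxed chase step with a full principal GTGD. Only
side facts are inherited when a child is created. -/
def ExemptChaseStep (Sig : Set (TGD S X)) (side : Set S.Rel) (T T' : ChaseTree S V) : Prop :=
  ∃ γ ∈ Sig, ∃ τ : X → V,
    (γ.IsSideTGD side ∧ FullStep γ τ T.recent T T') ∨
    ∃ H : RelInstance S V, (∀ F ∈ H, F.IsSide side) ∧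
      (NonFullStep γ τ T.recent H T T' ∨
        (γ.IsPrincipalTGD side ∧ RelaxedFullStep γ τ T.recent H T T'))

/-- One step of the principal-exempt one-pass chase: a propagation of one side fact to the parent, or,
only if no such propagation applies, a chase step. -/
def ExemptStep (Sig : Set (TGD S X)) (side : Set S.Rel) (T T' : ChaseTree S V) : Prop :=
  SidePropagationStep side T T' ∨
    ((¬ ∃ T'' : ChaseTree S V, SidePropagationStep side T T'') ∧ ExemptChaseStep Sig side T T')

end ChaseTree

/-! ## Chase sequences and chase proofs -/

section Sequences

variable {S : RelSignature.{u}} {X : Type v} {V : Type w}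

/-- `T₀, …, Tₙ` is a relaxed tree-like chase sequence for the instance `I` and the dependencies
`Sig`. -/
structure IsRelaxedChase (Sig : Set (TGD S X)) (I : RelInstance S V) (n : ℕ)
    (T : Fin (n + 1) → ChaseTree S V) : Prop where
  init : (T 0).IsInitial I
  step : ∀ i : Fin n, ChaseTree.RelaxedStep Sig (T i.castSucc) (T i.succ)

/-- `T₀, …, Tₙ` is a principal-exempt one-pass chase for the instance `I` and the dependencies
`Sig` with side signature `side`: a relaxed tree-like chase sequence all of whose steps are
principal-exempt one-pass steps. -/
structure IsPrincipalExemptOnePass (Sig : Set (TGD S X)) (side : Set S.Rel) (I : RelInstance S V)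
    (n : ℕ) (T : Fin (n + 1) → ChaseTree S V) : Prop where
  relaxed : IsRelaxedChase Sig I n T
  exempt : ∀ i : Fin n, ChaseTree.ExemptStep Sig side (T i.castSucc) (T i.succ)

/-- `T₀, …, Tₙ` is a principal-exempt one-pass tree-like chase proof of the fact `F`: moreover `F`
occurs in some node of the last tree. -/
def IsPrincipalExemptProof (Sig : Set (TGD S X)) (side : Set S.Rel) (I : RelInstance S V)
    (F : GroundFact S V) (n : ℕ) (T : Fin (n + 1) → ChaseTree S V) : Prop :=
  IsPrincipalExemptOnePass Sig side I n T ∧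
    ∃ m ∈ (T (Fin.last n)).nodes, F ∈ (T (Fin.last n)).facts m

end Sequences

end GTGDChase

open GTGDChase

namespace GTGDChase

universe u v w

variable {S : RelSignature.{u}} {X : Type v} {V : Type w}

/-! ## Active domains, finiteness -/

/-! A one-pass chase abandons every subtree that it leaves upwards, so one chase cannot hold all
consequences. The plan is instead to build a model of `Sig` whose facts are each reached by some
chase of their own; an entailed fact lies in this model, hence has a proof.

Chases are cut into macro steps between coherent trees, where no propagation is pending: either a
child is created, or a full side GTGD is fired and its head climbs to the topmost node of the branch
guarding it. The values of a node never change and only finitely many relations matter, so a node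
can grow only finitely often. Hence one can reach a saturated tree, from which no continuation
brings new facts back to the current branch (`Coherent.exists_saturated`). There, heads of full side
triggers are already present (`Saturated.head_mem`), and any other trigger yields a child that can
be saturated in turn without altering its parent (`Saturated.exists_child`).

The model is the union of the bags of saturated trees, taken from different and possibly
incompatible chases. Fresh values avoid all bags chosen so far, so two bags agree on the side facts
over their common values (`BagFamily`). A trigger in the union therefore lies in the bag containing
its guard's image, and is satisfied by that bag or by a child's bag (`exists_model`). -/

lemma terms_subset_adom {I : RelInstance S V} {F : GroundFact S V} (h : F ∈ I) :
    F.terms ⊆ adom I := fun _ ha => ⟨F, h, ha⟩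

lemma adom_mono {I J : RelInstance S V} (h : I ⊆ J) : adom I ⊆ adom J :=
  fun _ ⟨F, hF, ha⟩ => ⟨F, h hF, ha⟩

lemma guardedBy_singleton {I : RelInstance S V} {F : GroundFact S V} :
    GuardedBy {F} I ↔ F.terms ⊆ adom I :=
  ⟨fun h _ ha => h ⟨F, rfl, ha⟩, fun h _ ⟨_, hG, ha⟩ => h (by rw [← Set.mem_singleton_iff.1 hG]; exact ha)⟩

lemma adom_singleton (F : GroundFact S V) : adom ({F} : RelInstance S V) = F.terms := by
  ext a
  simp [adom]

lemma adom_insert_of_subset {I : RelInstance S V} {F : GroundFact S V} (h : F.terms ⊆ adom I) :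
    adom (insert F I) = adom I := by
  refine Set.Subset.antisymm ?_ (adom_mono (Set.subset_insert _ _))
  rintro a ⟨G, rfl | hG, ha⟩
  exacts [h ha, ⟨G, hG, ha⟩]

lemma adom_finite {I : RelInstance S V} (hI : I.Finite) : (adom I).Finite := by
  have : adom I = ⋃ F ∈ I, F.terms := by
    ext a
    simp [adom]
  rw [this]
  exact hI.biUnion fun F _ => Set.finite_range _

/-- There are finitely many facts over finitely many relations and finitely many values. -/
lemma finite_facts_of_finite {R : Set S.Rel} (hR : R.Finite) {D : Set V} (hD : D.Finite) :
    {F : GroundFact S V | F.rel ∈ R ∧ F.terms ⊆ D}.Finite := by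
  have : {F : GroundFact S V | F.rel ∈ R ∧ F.terms ⊆ D} ⊆
      ⋃ r ∈ R, (fun a => (⟨r, a⟩ : GroundFact S V)) '' (Set.univ.pi fun _ => D) := by
    rintro ⟨r, a⟩ ⟨hr, ha⟩
    simp only [Set.mem_iUnion]
    exact ⟨r, hr, a, fun i _ => ha ⟨i, rfl⟩, rfl⟩
  exact (hR.biUnion fun r _ => (Set.Finite.pi fun _ => hD).image _).subset this

lemma mem_terms_subst {T : Type*} {T' : Type*} {A : RelAtom S T} {f : T → T'} {a : T'} :
    a ∈ (A.subst f).terms ↔ ∃ t ∈ A.terms, f t = a := by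
  constructor
  · rintro ⟨i, rfl⟩
    exact ⟨_, ⟨i, rfl⟩, rfl⟩
  · rintro ⟨_, ⟨i, rfl⟩, rfl⟩
    exact ⟨i, rfl⟩

lemma subst_congr {T : Type*} {T' : Type*} {A : RelAtom S T} {f g : T → T'}
    (h : Set.EqOn f g A.terms) : A.subst f = A.subst g := by
  simp only [RelAtom.subst, RelAtom.mk.injEq, heq_eq_eq, true_and]
  funext i
  exact h ⟨i, rfl⟩

lemma eqOn_of_subst_eq {T : Type*} {T' : Type*} {A : RelAtom S T} {f g : T → T'}
    (h : A.subst f = A.subst g) : Set.EqOn f g A.terms := by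
  simp only [RelAtom.subst, RelAtom.mk.injEq, heq_eq_eq, true_and] at h
  rintro _ ⟨i, rfl⟩
  exact congrFun h i

/-! ### Triggers, full heads and fresh values -/

namespace TGD

lemma IsTrigger.congr {γ : TGD S X} {τ τ' : X → V} {I : RelInstance S V}
    (h : γ.IsTrigger τ I) (he : Set.EqOn τ' τ γ.bodyVars) : γ.IsTrigger τ' I := by
  intro A hA
  rw [subst_congr fun x hx => he ⟨A, hA, hx⟩]
  exact h A hA

lemma IsTrigger.map_mem_adom {γ : TGD S X} {τ : X → V} {I : RelInstance S V}
    (h : γ.IsTrigger τ I) {x : X} (hx : x ∈ γ.bodyVars) : τ x ∈ adom I := by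
  obtain ⟨A, hA, hxA⟩ := hx
  exact ⟨_, h A hA, mem_terms_subst.2 ⟨x, hxA, rfl⟩⟩

lemma IsFull.head_subset {γ : TGD S X} (h : γ.IsFull) : γ.head.terms ⊆ γ.bodyVars :=
  Set.sdiff_eq_empty.1 h

lemma existVars_finite (γ : TGD S X) : γ.existVars.Finite :=
  (Set.finite_range _).subset Set.sdiff_subset

/-- A substitution can be changed on the existential variables so that these are mapped to distinct
values outside of a given finite set. -/
lemma exists_fresh_extension [Infinite V] (γ : TGD S X) (τ : X → V) {A : Set V} (hA : A.Finite) :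
    ∃ τ' : X → V, Set.EqOn τ' τ γ.bodyVars ∧ Set.InjOn τ' γ.existVars ∧
      ∀ y ∈ γ.existVars, τ' y ∉ A := by
  classical
  obtain ⟨f, hf⟩ := Set.countable_iff_exists_injOn.1 γ.existVars_finite.countable
  let e := hA.infinite_compl.natEmbedding
  refine ⟨fun x => if x ∈ γ.existVars then e (f x) else τ x, ?_, ?_, ?_⟩
  · intro x hx
    exact if_neg fun h => h.2 hx
  · intro x hx y hy hxy
    simp only [if_pos hx, if_pos hy] at hxy
    exact hf hx hy (e.injective (Subtype.ext hxy))
  · intro y hy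
    simp only [if_pos hy]
    exact (e (f y)).2

end TGD

namespace ChaseTree

/-! ## Trees obtained by chase steps on the recently updated node -/

lemma mem_nodes_of_suffix (T : ChaseTree S V) {r s : List ℕ} (h : r <:+ s) (hs : s ∈ T.nodes) :
    r ∈ T.nodes := by
  induction s with
  | nil => rwa [List.suffix_nil.1 h]
  | cons k p ih =>
    rcases List.suffix_cons_iff.1 h with rfl | h
    exacts [hs, ih h (T.parent_mem k p hs)]

lemma facts_subset_underlying (T : ChaseTree S V) {n : List ℕ} (h : n ∈ T.nodes) :
    T.facts n ⊆ T.underlying := fun _ hF => ⟨n, h, hF⟩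

lemma underlying_finite (T : ChaseTree S V) (h : T.nodes.Finite) : T.underlying.Finite := by
  have : T.underlying = ⋃ n ∈ T.nodes, T.facts n := by
    ext F
    simp [underlying]
  rw [this]
  exact h.biUnion T.facts_finite

/-- The facts of the recently updated node. -/
def bag (T : ChaseTree S V) : RelInstance S V := T.facts T.recent

lemma bag_finite (T : ChaseTree S V) : T.bag.Finite := T.facts_finite _ T.recent_mem

lemma bag_subset_underlying (T : ChaseTree S V) : T.bag ⊆ T.underlying :=
  T.facts_subset_underlying T.recent_mem

/-- The tree with only a root, which contains the finite instance `I`. -/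
def single (I : RelInstance S V) (hI : I.Finite) : ChaseTree S V where
  nodes := {[]}
  root_mem := rfl
  parent_mem := fun k p h => by simp at h
  facts := fun _ => I
  facts_finite := fun _ _ => hI
  recent := []
  recent_mem := rfl

/-- The tree obtained by creating a child of the recently updated node. -/
def addChild (T : ChaseTree S V) (k : ℕ) (G : GroundFact S V) (H : RelInstance S V)
    (hH : H ⊆ T.bag) : ChaseTree S V where
  nodes := insert (k :: T.recent) T.nodes
  root_mem := Or.inr T.root_mem
  parent_mem := by
    rintro j p (h | h)
    · obtain ⟨-, rfl⟩ := List.cons.inj h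
      exact Or.inr T.recent_mem
    · exact Or.inr (T.parent_mem j p h)
  facts := Function.update T.facts (k :: T.recent) (insert G H)
  facts_finite := by
    intro n hn
    by_cases h : n = k :: T.recent
    · subst h
      rw [Function.update_self]
      exact (T.bag_finite.subset hH).insert G
    · rw [Function.update_of_ne h]
      exact T.facts_finite n (hn.resolve_left h)
  recent := k :: T.recent
  recent_mem := Or.inl rfl

open Classical in
/-- The tree obtained by inserting a fact into the recently updated node and its ancestors up to
the node `r`. -/
def insertUpTo (T : ChaseTree S V) (F : GroundFact S V) (r : List ℕ) (hr : r <:+ T.recent) :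
    ChaseTree S V where
  nodes := T.nodes
  root_mem := T.root_mem
  parent_mem := T.parent_mem
  facts := fun n => if r <:+ n ∧ n <:+ T.recent then insert F (T.facts n) else T.facts n
  facts_finite := by
    intro n hn
    split_ifs
    exacts [(T.facts_finite n hn).insert F, T.facts_finite n hn]
  recent := r
  recent_mem := T.mem_nodes_of_suffix hr T.recent_mem

section addChild

variable {T : ChaseTree S V} {k : ℕ} {G : GroundFact S V} {H : RelInstance S V} {hH : H ⊆ T.bag}

lemma addChild_facts_self : (T.addChild k G H hH).facts (k :: T.recent) = insert G H :=
  Function.update_self ..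

lemma addChild_bag : (T.addChild k G H hH).bag = insert G H := addChild_facts_self

lemma addChild_facts_of_mem (hk : k :: T.recent ∉ T.nodes) {n : List ℕ} (hn : n ∈ T.nodes) :
    (T.addChild k G H hH).facts n = T.facts n :=
  Function.update_of_ne (ne_of_mem_of_not_mem hn hk) ..

lemma addsChild_addChild (hk : k :: T.recent ∉ T.nodes) (hg : ∀ F ∈ H, F.terms ⊆ G.terms) :
    AddsChild T.recent G H T (T.addChild k G H hH) where
  node_mem := T.recent_mem
  inherited := fun F hF =>
    ⟨hH hF, guardedBy_singleton.2 (by rw [adom_singleton]; exact hg F hF)⟩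
  child := ⟨k, hk, rfl, addChild_facts_self, rfl⟩
  facts_other := fun _ hm => addChild_facts_of_mem hk hm

lemma mem_underlying_addChild (hk : k :: T.recent ∉ T.nodes) {F : GroundFact S V}
    (h : F ∈ (T.addChild k G H hH).underlying) : F = G ∨ F ∈ T.underlying := by
  obtain ⟨n, rfl | hn, hF⟩ := h
  · rw [addChild_facts_self] at hF
    exact hF.imp_right fun h => T.bag_subset_underlying (hH h)
  · rw [addChild_facts_of_mem hk hn] at hF
    exact Or.inr ⟨n, hn, hF⟩

end addChild

section insertUpTo

variable {T : ChaseTree S V} {F : GroundFact S V} {r : List ℕ} {hr : r <:+ T.recent}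

lemma insertUpTo_facts_of_suffix {n : List ℕ} (h : r <:+ n) (hn : n <:+ T.recent) :
    (T.insertUpTo F r hr).facts n = insert F (T.facts n) := if_pos ⟨h, hn⟩

lemma insertUpTo_facts_of_not {n : List ℕ} (h : ¬ (r <:+ n ∧ n <:+ T.recent)) :
    (T.insertUpTo F r hr).facts n = T.facts n := if_neg h

lemma insertUpTo_bag : (T.insertUpTo F r hr).bag = insert F (T.facts r) :=
  insertUpTo_facts_of_suffix (List.suffix_refl r) hr

lemma facts_subset_insertUpTo (n : List ℕ) : T.facts n ⊆ (T.insertUpTo F r hr).facts n := by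
  by_cases h : r <:+ n ∧ n <:+ T.recent
  · rw [insertUpTo_facts_of_suffix h.1 h.2]
    exact Set.subset_insert _ _
  · rw [insertUpTo_facts_of_not h]

lemma mem_underlying_insertUpTo {G : GroundFact S V} (h : G ∈ (T.insertUpTo F r hr).underlying) :
    G = F ∨ G ∈ T.underlying := by
  obtain ⟨n, hn, hG⟩ := h
  by_cases h : r <:+ n ∧ n <:+ T.recent
  · rw [insertUpTo_facts_of_suffix h.1 h.2] at hG
    exact hG.imp_right fun hG => ⟨n, hn, hG⟩
  · rw [insertUpTo_facts_of_not h] at hG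
    exact Or.inr ⟨n, hn, hG⟩

lemma adom_insertUpTo_facts (hF : ∀ n, r <:+ n → n <:+ T.recent → F.terms ⊆ adom (T.facts n))
    (n : List ℕ) : adom ((T.insertUpTo F r hr).facts n) = adom (T.facts n) := by
  by_cases h : r <:+ n ∧ n <:+ T.recent
  · rw [insertUpTo_facts_of_suffix h.1 h.2, adom_insert_of_subset (hF n h.1 h.2)]
  · rw [insertUpTo_facts_of_not h]

end insertUpTo

/-! ## Coherent trees -/

/-- A tree is coherent if each side fact is contained in all the nodes guarding it on the branch of the
recently updated node, and values are connected along this branch. -/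
structure Coherent (side R : Set S.Rel) (T : ChaseTree S V) : Prop where
  finite_nodes : T.nodes.Finite
  rel_mem : ∀ F ∈ T.underlying, F.rel ∈ R
  side_mem : ∀ n, n <:+ T.recent → ∀ F ∈ T.underlying, F.IsSide side →
    F.terms ⊆ adom (T.facts n) → F ∈ T.facts n
  connected : ∀ n m l, n <:+ m → m <:+ l → l <:+ T.recent →
    adom (T.facts n) ∩ adom (T.facts l) ⊆ adom (T.facts m)

variable {side R : Set S.Rel} {Sig : Set (TGD S X)} {T T' : ChaseTree S V}

/-- A side fact guarded by the parent is already there by coherence. This is what makes chase steps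
legal, since they require that no propagation applies. -/
lemma Coherent.not_sidePropagationStep (h : T.Coherent side R) :
    ¬ ∃ T' : ChaseTree S V, SidePropagationStep side T T' := by
  rintro ⟨T', k, p, F, hr, hF, hP⟩
  have hmem := h.side_mem p (hr ▸ List.suffix_cons k p) F
    ⟨_, hP.source_mem, hP.subset rfl⟩ hF (guardedBy_singleton.1 hP.guarded)
  have : F ∈ T.facts p ∩ {F} := ⟨hmem, rfl⟩
  rw [hP.disjoint] at this
  exact this

lemma coherent_single {I : RelInstance S V} (hI : I.Finite) (hR : ∀ F ∈ I, F.rel ∈ R) :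
    (single I hI).Coherent side R where
  finite_nodes := Set.finite_singleton _
  rel_mem := fun F ⟨_, _, hF⟩ => hR F hF
  side_mem := fun _ _ _ ⟨_, _, hF⟩ _ _ => hF
  connected := fun _ _ _ _ _ _ _ h => h.1

/-- The side facts of the recently updated node that are guarded by `G`. -/
def inheritedFacts (side : Set S.Rel) (T : ChaseTree S V) (G : GroundFact S V) : RelInstance S V :=
  {F | F ∈ T.bag ∧ F.IsSide side ∧ F.terms ⊆ G.terms}

lemma inheritedFacts_subset (T : ChaseTree S V) (G : GroundFact S V) :
    inheritedFacts side T G ⊆ T.bag := fun _ h => h.1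

lemma adom_insert_inheritedFacts (T : ChaseTree S V) (G : GroundFact S V) :
    adom (insert G (inheritedFacts side T G)) = G.terms := by
  refine Set.Subset.antisymm ?_ (terms_subset_adom (Set.mem_insert _ _))
  rintro a ⟨F, rfl | hF, ha⟩
  exacts [ha, hF.2.2 ha]

/-- By `hold`, the child shares with the old tree only values of the current node; this preserves
connectivity and ensures that inheritance from that node misses no side fact. By `hnew`, no old node
guards a side head; a principal head owes nothing to its ancestors, so it needs no fresh value. -/
lemma Coherent.addChild (h : T.Coherent side R) {k : ℕ} (hk : k :: T.recent ∉ T.nodes)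
    {G : GroundFact S V} (hGR : G.rel ∈ R)
    (hold : ∀ a ∈ G.terms, a ∈ adom T.underlying → a ∈ adom T.bag)
    (hnew : G.IsSide side → ∃ a ∈ G.terms, a ∉ adom T.underlying) :
    (T.addChild k G _ (T.inheritedFacts_subset (side := side) G)).Coherent side R where
  finite_nodes := h.finite_nodes.insert _
  rel_mem := by
    intro F hF
    rcases mem_underlying_addChild hk hF with rfl | hF
    exacts [hGR, h.rel_mem F hF]
  side_mem := by
    intro n hn F hF hside hterms
    rcases List.suffix_cons_iff.1 hn with rfl | hn
    · rw [addChild_facts_self, adom_insert_inheritedFacts] at hterms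
      rw [addChild_facts_self]
      rcases mem_underlying_addChild hk hF with rfl | hF
      · exact Or.inl rfl
      · exact Or.inr ⟨h.side_mem _ (List.suffix_refl _) F hF hside fun a ha =>
          hold a (hterms ha) ⟨F, hF, ha⟩, hside, hterms⟩
    · have hnn := T.mem_nodes_of_suffix hn T.recent_mem
      rw [addChild_facts_of_mem hk hnn] at hterms ⊢
      rcases mem_underlying_addChild hk hF with rfl | hF
      · obtain ⟨a, ha, ha'⟩ := hnew hside
        exact absurd (adom_mono (T.facts_subset_underlying hnn) (hterms ha)) ha'
      · exact h.side_mem n hn F hF hside hterms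
  connected := by
    intro n m l hnm hml hl
    rcases List.suffix_cons_iff.1 hl with rfl | hl
    · rcases List.suffix_cons_iff.1 hml with rfl | hm
      · exact Set.inter_subset_right
      · have hmn := T.mem_nodes_of_suffix hm T.recent_mem
        have hnn := T.mem_nodes_of_suffix hnm hmn
        rw [addChild_facts_self, adom_insert_inheritedFacts, addChild_facts_of_mem hk hmn,
          addChild_facts_of_mem hk hnn]
        rintro a ⟨ha, haG⟩
        exact h.connected n m _ hnm hm (List.suffix_refl _)
          ⟨ha, hold a haG (adom_mono (T.facts_subset_underlying hnn) ha)⟩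
    · have hln := T.mem_nodes_of_suffix hl T.recent_mem
      have hmn := T.mem_nodes_of_suffix hml hln
      have hnn := T.mem_nodes_of_suffix hnm hmn
      rw [addChild_facts_of_mem hk hln, addChild_facts_of_mem hk hmn, addChild_facts_of_mem hk hnn]
      exact h.connected n m l hnm hml hl

/-- The insertions change no active domain, so old facts cause no trouble. For `F`, minimality of
`r` means that no node strictly above it on the branch is required to contain it. -/
lemma Coherent.insertUpTo (h : T.Coherent side R) {F : GroundFact S V} (hFR : F.rel ∈ R)
    {r : List ℕ} (hr : r <:+ T.recent)
    (hF : ∀ n, r <:+ n → n <:+ T.recent → F.terms ⊆ adom (T.facts n))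
    (hmin : ∀ n, n <:+ r → F.terms ⊆ adom (T.facts n) → n = r) :
    (T.insertUpTo F r hr).Coherent side R where
  finite_nodes := h.finite_nodes
  rel_mem := by
    intro G hG
    rcases mem_underlying_insertUpTo hG with rfl | hG
    exacts [hFR, h.rel_mem G hG]
  side_mem := by
    intro n hn G hG hside hterms
    rw [adom_insertUpTo_facts hF] at hterms
    rcases mem_underlying_insertUpTo hG with rfl | hG
    · obtain rfl := hmin n hn hterms
      rw [insertUpTo_facts_of_suffix (List.suffix_refl _) hr]
      exact Or.inl rfl
    · exact facts_subset_insertUpTo n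
        (h.side_mem n (List.IsSuffix.trans hn hr) G hG hside hterms)
  connected := by
    intro n m l hnm hml hl
    simp only [adom_insertUpTo_facts hF]
    exact h.connected n m l hnm hml (List.IsSuffix.trans hl hr)

/-! ## Macro steps between coherent trees -/

/-- A sequence of exempt steps leading to a coherent tree, which either creates a child of the recently
updated node, or adds a fact to a node of its branch without changing the nodes above. -/
structure MacroStep (Sig : Set (TGD S X)) (side R : Set S.Rel) (T T' : ChaseTree S V) : Prop where
  steps : Relation.ReflTransGen (ExemptStep Sig side) T T'
  coherent : T'.Coherent side R
  nodes_subset : T.nodes ⊆ T'.nodes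
  facts_subset : ∀ n ∈ T.nodes, T.facts n ⊆ T'.facts n
  adom_eq : ∀ n ∈ T.nodes, adom (T'.facts n) = adom (T.facts n)
  move : (∃ k, T'.recent = k :: T.recent ∧ ∀ n, n <:+ T.recent → T'.facts n = T.facts n) ∨
    (T'.recent <:+ T.recent ∧ T.facts T'.recent ⊂ T'.facts T'.recent ∧
      ∀ n, n <:+ T'.recent → n ≠ T'.recent → T'.facts n = T.facts n)

lemma suffix_antisymm {r s : List ℕ} (h : r <:+ s) (h' : s <:+ r) : r = s :=
  h.eq_of_length_le h'.length_le

/-- The fact is created at the bottom and then climbs one edge at a time; `l` is the stretch of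
address to climb. Addresses grow at the front, so the last edge climbed corresponds to the last
entry of `l`, whence the reverse induction. -/
lemma reflTransGen_insertUpTo {F : GroundFact S V} (hside : F.IsSide side)
    (hnew : F ∉ T.underlying)
    (hstep : ExemptStep Sig side T (T.insertUpTo F T.recent (List.suffix_refl _)))
    (l : List ℕ) : ∀ (r : List ℕ) (hr : r <:+ T.recent), T.recent = l ++ r →
    (∀ n, r <:+ n → n <:+ T.recent → F.terms ⊆ adom (T.facts n)) →
    Relation.ReflTransGen (ExemptStep Sig side) T (T.insertUpTo F r hr) := by
  induction l using List.reverseRecOn with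
  | nil =>
    intro r hr he _
    obtain rfl : T.recent = r := by simpa using he
    exact .single hstep
  | append_singleton l k ih =>
    intro r hr he hF
    have he' : T.recent = l ++ (k :: r) := by simpa using he
    have hkr : k :: r <:+ T.recent := ⟨l, he'.symm⟩
    refine .tail (ih (k :: r) hkr he' fun n hn => hF n ((List.suffix_cons k r).trans hn)) (Or.inl ?_)
    have hrn := T.mem_nodes_of_suffix hr T.recent_mem
    have hnot : ∀ n, n <:+ r → ¬ (k :: r <:+ n ∧ n <:+ T.recent) := fun n hn h => by
      have h1 := h.1.length_le
      have h2 := hn.length_le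
      simp at h1
      omega
    refine ⟨k, r, F, rfl, hside, ?_⟩
    exact {
      source_mem := T.mem_nodes_of_suffix hkr T.recent_mem
      target_mem := hrn
      nonempty := Set.singleton_nonempty F
      subset := by
        rw [insertUpTo_facts_of_suffix (List.suffix_refl _) hkr]
        exact Set.singleton_subset_iff.2 (Or.inl rfl)
      disjoint := by
        rw [insertUpTo_facts_of_not (hnot r (List.suffix_refl _))]
        exact Set.disjoint_iff_inter_eq_empty.1
          (Set.disjoint_singleton_right.2 fun h => hnew ⟨r, hrn, h⟩)
      guarded := by
        rw [insertUpTo_facts_of_not (hnot r (List.suffix_refl _)), guardedBy_singleton]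
        exact hF r (List.suffix_refl _) hr
      nodes_eq := rfl
      facts_target := by
        rw [insertUpTo_facts_of_not (hnot r (List.suffix_refl _)),
          insertUpTo_facts_of_suffix (List.suffix_refl _) hr, Set.union_singleton]
      facts_other := by
        intro n _ hne
        by_cases h : n <:+ T.recent ∧ r <:+ n
        · have h' : k :: r <:+ n := by
            rcases List.suffix_or_suffix_of_suffix h.1 hkr with h1 | h1
            · rcases List.suffix_cons_iff.1 h1 with rfl | h2
              · exact List.suffix_refl _
              · exact absurd (suffix_antisymm h2 h.2) hne
            · exact h1
          rw [insertUpTo_facts_of_suffix h.2 h.1, insertUpTo_facts_of_suffix h' h.1]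
        · rw [insertUpTo_facts_of_not fun h' => h ⟨h'.2, h'.1⟩,
            insertUpTo_facts_of_not fun h' => h ⟨h'.2, (List.suffix_cons k r).trans h'.1⟩]
      recent_eq := rfl }

/-- A full side trigger whose head does not occur in the tree gives a macro step which adds the head
to some node of the branch. -/
lemma Coherent.exists_macroStep_full (h : T.Coherent side R) {γ : TGD S X} (hγ : γ ∈ Sig)
    (hfull : γ.IsFull) (hside : γ.IsSideTGD side) (hR : γ.head.rel ∈ R) {τ : X → V}
    (hτ : γ.IsTrigger τ T.bag) (hnew : γ.head.subst τ ∉ T.underlying) :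
    ∃ T', MacroStep Sig side R T T' ∧ T'.recent <:+ T.recent ∧
      T.facts T'.recent ⊂ T'.facts T'.recent := by
  classical
  set F := γ.head.subst τ with hFdef
  have hFbag : F.terms ⊆ adom T.bag := by
    intro a ha
    obtain ⟨x, hx, rfl⟩ := mem_terms_subst.1 ha
    exact hτ.map_mem_adom (hfull.head_subset hx)
  have hstep : ExemptStep Sig side T (T.insertUpTo F T.recent (List.suffix_refl _)) := by
    refine Or.inr ⟨h.not_sidePropagationStep, γ, hγ, τ, Or.inl ⟨hside, ?_⟩⟩
    exact {
      full := hfull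
      node_mem := T.recent_mem
      trigger := hτ
      fact_new := hnew
      nodes_eq := rfl
      facts_node := insertUpTo_bag
      facts_other := fun n _ hn =>
        insertUpTo_facts_of_not fun h' => hn (suffix_antisymm h'.2 h'.1)
      recent_eq := rfl }
  -- The destination `r` is the guarding node of least depth on the branch. Connectivity then makes
  -- every node between `r` and the bottom guard the fact, so the climb is not interrupted.
  have hex : ∃ m, ∃ r, r <:+ T.recent ∧ F.terms ⊆ adom (T.facts r) ∧ r.length = m :=
    ⟨_, _, List.suffix_refl _, hFbag, rfl⟩
  obtain ⟨r, hr, hrF, hlen⟩ := Nat.find_spec hex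
  have hmin : ∀ n, n <:+ r → F.terms ⊆ adom (T.facts n) → n = r := fun n hn hnF =>
    hn.eq_of_length_le (hlen ▸ Nat.find_min' hex ⟨n, hn.trans hr, hnF, rfl⟩)
  have hF : ∀ n, r <:+ n → n <:+ T.recent → F.terms ⊆ adom (T.facts n) := fun n hrn hn a ha =>
    h.connected r n _ hrn hn (List.suffix_refl _) ⟨hrF ha, hFbag ha⟩
  have hlt : T.facts r ⊂ (T.insertUpTo F r hr).facts r := by
    rw [insertUpTo_facts_of_suffix (List.suffix_refl _) hr]
    exact Set.ssubset_insert fun h' => hnew ⟨r, T.mem_nodes_of_suffix hr T.recent_mem, h'⟩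
  obtain ⟨l, hl⟩ := id hr
  refine ⟨T.insertUpTo F r hr, ?_, hr, hlt⟩
  exact {
    steps := reflTransGen_insertUpTo (F := F) hside hnew hstep l r hr hl.symm hF
    coherent := h.insertUpTo hR hr hF hmin
    nodes_subset := subset_rfl
    facts_subset := fun n _ => facts_subset_insertUpTo n
    adom_eq := fun n _ => adom_insertUpTo_facts hF n
    move := Or.inr ⟨hr, hlt, fun n hn hne =>
      insertUpTo_facts_of_not fun h' => hne (suffix_antisymm hn h'.1)⟩ }

lemma exists_child_not_mem_nodes (h : T.nodes.Finite) (n : List ℕ) : ∃ k, k :: n ∉ T.nodes := by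
  by_contra! hk
  exact Set.infinite_of_injective_forall_mem (f := fun k : ℕ => k :: n)
    (fun a b hab => (List.cons.inj hab).1) hk h

/-- A trigger that is not full or not side gives a macro step creating a child for the head, with
values outside of a given finite set for the existential variables. -/
lemma Coherent.exists_macroStep_child [Infinite V] (h : T.Coherent side R) {γ : TGD S X}
    (hγ : γ ∈ Sig) (hns : ¬ (γ.IsFull ∧ γ.IsSideTGD side)) (hR : γ.head.rel ∈ R) {τ : X → V}
    (hτ : γ.IsTrigger τ T.bag) {D : Set V} (hD : D.Finite) :
    ∃ T' τ', MacroStep Sig side R T T' ∧ Set.EqOn τ' τ γ.bodyVars ∧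
      (∃ k, T'.recent = k :: T.recent) ∧ (∀ n, n <:+ T.recent → T'.facts n = T.facts n) ∧
      T'.bag = insert (γ.head.subst τ') (inheritedFacts side T (γ.head.subst τ')) ∧
      ∀ a ∈ (γ.head.subst τ').terms, a ∈ D → a ∈ adom T.bag := by
  obtain ⟨k, hk⟩ := exists_child_not_mem_nodes h.finite_nodes T.recent
  -- Besides the values of the tree, the set `D` is avoided: it will hold the values of bags from
  -- other chases.
  obtain ⟨τ', heq, hinj, hfresh⟩ := γ.exists_fresh_extension τ
    (hD.union (adom_finite (T.underlying_finite h.finite_nodes)))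
  set G := γ.head.subst τ' with hG
  have hadds := addsChild_addChild (T := T) (G := G) (hH := T.inheritedFacts_subset (side := side) G)
    hk fun F hF => hF.2.2
  have hterms : ∀ a ∈ G.terms, a ∈ D ∪ adom T.underlying → a ∈ adom T.bag := by
    intro a ha haD
    obtain ⟨x, hx, rfl⟩ := mem_terms_subst.1 ha
    by_cases hxb : x ∈ γ.bodyVars
    · exact (hτ.congr heq).map_mem_adom hxb
    · exact absurd haD (hfresh x ⟨hx, hxb⟩)
  have hnew : G.IsSide side → ∃ a ∈ G.terms, a ∉ adom T.underlying := by
    intro hs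
    have hnf : ¬ γ.IsFull := fun hf => hns ⟨hf, hs⟩
    obtain ⟨y, hy⟩ := Set.nonempty_iff_ne_empty.2 hnf
    exact ⟨τ' y, mem_terms_subst.2 ⟨y, hy.1, rfl⟩, fun h' => hfresh y hy (Or.inr h')⟩
  have hchain : ∀ n, n <:+ T.recent →
      (T.addChild k G _ (T.inheritedFacts_subset (side := side) G)).facts n = T.facts n :=
    fun n hn => addChild_facts_of_mem hk (T.mem_nodes_of_suffix hn T.recent_mem)
  refine ⟨T.addChild k G _ (T.inheritedFacts_subset (side := side) G), τ', ?_, heq, ⟨k, rfl⟩,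
    hchain, addChild_bag, fun a ha haD => hterms a ha (Or.inl haD)⟩
  refine {
    steps := .single (Or.inr ⟨h.not_sidePropagationStep, γ, hγ, τ, Or.inr
      ⟨inheritedFacts side T G, fun F hF => hF.2.1, ?_⟩⟩)
    coherent := h.addChild hk hR (fun a ha ha' => hterms a ha (Or.inr ha')) hnew
    nodes_subset := Set.subset_insert _ _
    facts_subset := fun n hn => (addChild_facts_of_mem hk hn).symm.subset
    adom_eq := fun n hn => by rw [addChild_facts_of_mem hk hn]
    move := Or.inl ⟨k, rfl, hchain⟩ }
  by_cases hf : γ.IsFull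
  · refine Or.inr ⟨fun hs => hns ⟨hf, hs⟩, hf, hτ, ?_⟩
    have : γ.head.subst τ = G := subst_congr fun x hx => (heq (hf.head_subset hx)).symm
    rw [this]
    exact hadds
  · exact Or.inl ⟨hf, hτ, τ', heq, hinj, fun y hy h' => hfresh y hy (Or.inr h'), hadds⟩

/-! ## Saturated trees -/

/-- Sequences of macro steps. -/
abbrev MacroSteps (Sig : Set (TGD S X)) (side R : Set S.Rel) : ChaseTree S V → ChaseTree S V → Prop :=
  Relation.ReflTransGen (MacroStep Sig side R)

lemma MacroSteps.steps (h : MacroSteps Sig side R T T') :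
    Relation.ReflTransGen (ExemptStep Sig side) T T' := by
  induction h with
  | refl => rfl
  | tail _ h ih => exact ih.trans h.steps

lemma MacroSteps.coherent (h : MacroSteps Sig side R T T') (hT : T.Coherent side R) :
    T'.Coherent side R := by
  cases h with
  | refl => exact hT
  | tail _ h => exact h.coherent

lemma MacroSteps.nodes_subset (h : MacroSteps Sig side R T T') : T.nodes ⊆ T'.nodes := by
  induction h with
  | refl => rfl
  | tail _ h ih => exact ih.trans h.nodes_subset

lemma MacroSteps.facts_subset (h : MacroSteps Sig side R T T') {n : List ℕ} (hn : n ∈ T.nodes) :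
    T.facts n ⊆ T'.facts n := by
  induction h with
  | refl => rfl
  | tail h' h ih => exact ih.trans (h.facts_subset n (MacroSteps.nodes_subset h' hn))

lemma MacroSteps.adom_eq (h : MacroSteps Sig side R T T') {n : List ℕ} (hn : n ∈ T.nodes) :
    adom (T'.facts n) = adom (T.facts n) := by
  induction h with
  | refl => rfl
  | tail h' h ih => exact (h.adom_eq n (MacroSteps.nodes_subset h' hn)).trans ih

/-- The tree `T'` is an update of `T` at a node of the branch `n`: its recently updated node is on that
branch and has new facts. -/
def UpdatesBranch (n : List ℕ) (T T' : ChaseTree S V) : Prop :=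
  T'.recent <:+ n ∧ T.facts T'.recent ⊂ T'.facts T'.recent

/-- A tree is saturated if macro steps cannot come back with new facts to the branch of the recently
updated node. -/
def Saturated (Sig : Set (TGD S X)) (side R : Set S.Rel) (T : ChaseTree S V) : Prop :=
  ∀ T', MacroSteps Sig side R T T' → ¬ UpdatesBranch T.recent T T'

/-- While the current node stays at or below `n`, creating a child only goes deeper, and an update
either hits the branch of `n`, which is the first alternative, or happens strictly below `n` and
leaves that branch untouched. -/
lemma MacroSteps.updates_or_eq {n : List ℕ} (h : MacroSteps Sig side R T T')
    (hn : n <:+ T.recent) :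
    (∃ T₁, MacroSteps Sig side R T T₁ ∧ UpdatesBranch n T T₁) ∨
      (n <:+ T'.recent ∧ ∀ m, m <:+ n → T'.facts m = T.facts m) := by
  induction h with
  | refl => exact Or.inr ⟨hn, fun _ _ => rfl⟩
  | @tail T₁ T₂ h₁ h₂ ih =>
    rcases ih with ih | ⟨hn₁, ih⟩
    · exact Or.inl ih
    · rcases h₂.move with ⟨k, hk, hf⟩ | ⟨hr, hlt, hf⟩
      · refine Or.inr ⟨hk ▸ hn₁.trans (List.suffix_cons _ _), fun m hm => ?_⟩
        rw [hf m (hm.trans hn₁), ih m hm]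
      · by_cases h : T₂.recent <:+ n
        · exact Or.inl ⟨T₂, h₁.tail h₂, h, by rw [← ih _ h]; exact hlt⟩
        · have h' := (List.suffix_or_suffix_of_suffix hn₁ hr).resolve_right h
          refine Or.inr ⟨h', fun m hm => ?_⟩
          rw [hf m (hm.trans h') fun he => h (he ▸ hm), ih m hm]

lemma Saturated.facts_eq (hs : Saturated Sig side R T) (h : MacroSteps Sig side R T T')
    {n : List ℕ} (hn : n <:+ T.recent) : T'.facts n = T.facts n := by
  rcases h.updates_or_eq (List.suffix_refl T.recent) with ⟨T₁, h₁, h₂⟩ | ⟨-, h₂⟩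
  exacts [absurd h₂ (hs T₁ h₁), h₂ n hn]

/-- If macro steps can only come back to the recently updated node itself, then this node can be
saturated. -/
lemma Coherent.exists_saturated (hRfin : R.Finite) (h : T.Coherent side R)
    (hback : ∀ T', MacroSteps Sig side R T T' → UpdatesBranch T.recent T T' →
      T'.recent = T.recent) :
    ∃ T', MacroSteps Sig side R T T' ∧ T'.recent = T.recent ∧ Saturated Sig side R T' := by
  have hfin := finite_facts_of_finite hRfin (adom_finite T.bag_finite)
  have hsub : ∀ T', MacroSteps Sig side R T T' → T'.recent = T.recent →
      T'.bag ⊆ {F : GroundFact S V | F.rel ∈ R ∧ F.terms ⊆ adom T.bag} := by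
    intro T' hT' hr F hF
    refine ⟨(hT'.coherent h).rel_mem F (T'.bag_subset_underlying hF), ?_⟩
    have := terms_subset_adom hF
    rwa [bag, hr, hT'.adom_eq T.recent_mem] at this
  -- The measure counts the possible facts over the fixed values that are still missing, so a
  -- minimum is a tree with a largest bag. By `hback`, any further update would enlarge this bag.
  obtain ⟨T', ⟨hT', hr⟩, hmax⟩ := WellFounded.has_min
    (measure fun T' : ChaseTree S V =>
      {F : GroundFact S V | F.rel ∈ R ∧ F.terms ⊆ adom T.bag}.ncard - T'.bag.ncard).wf
    {T' | MacroSteps Sig side R T T' ∧ T'.recent = T.recent} ⟨T, .refl, rfl⟩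
  refine ⟨T', hT', hr, fun T₁ hT₁ ⟨hsuf, hlt⟩ => ?_⟩
  have h₁ : T₁.recent = T.recent := by
    refine hback T₁ (hT'.trans hT₁) ⟨hr ▸ hsuf, lt_of_le_of_lt (hT'.facts_subset ?_) hlt⟩
    exact T.mem_nodes_of_suffix (hr ▸ hsuf) T.recent_mem
  refine hmax T₁ ⟨hT'.trans hT₁, h₁⟩ ?_
  have hlt' : T'.bag ⊂ T₁.bag := by
    rw [bag, bag, h₁, hr]
    rwa [h₁] at hlt
  have c₁ := Set.ncard_lt_ncard hlt' T₁.bag_finite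
  have c₂ := Set.ncard_le_ncard (hsub T₁ (hT'.trans hT₁) h₁) hfin
  exact Nat.sub_lt_sub_left (c₁.trans_le c₂) c₁

/-- In a saturated tree the recently updated node is closed under full side GTGDs. -/
lemma Saturated.head_mem (hs : Saturated Sig side R T) (h : T.Coherent side R) {γ : TGD S X}
    (hγ : γ ∈ Sig) (hfull : γ.IsFull) (hside : γ.IsSideTGD side) (hR : γ.head.rel ∈ R)
    {τ : X → V} (hτ : γ.IsTrigger τ T.bag) : γ.head.subst τ ∈ T.bag := by
  by_cases hnew : γ.head.subst τ ∈ T.underlying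
  · refine h.side_mem _ (List.suffix_refl _) _ hnew hside fun a ha => ?_
    obtain ⟨x, hx, rfl⟩ := mem_terms_subst.1 ha
    exact hτ.map_mem_adom (hfull.head_subset hx)
  · obtain ⟨T', hT', hu⟩ := h.exists_macroStep_full hγ hfull hside hR hτ hnew
    exact absurd hu (hs T' (.single hT'))

/-- A trigger in a saturated tree that is not full or not side has its head in a child which can be
saturated. -/
lemma Saturated.exists_child [Infinite V] (hRfin : R.Finite) (hs : Saturated Sig side R T)
    (h : T.Coherent side R) {γ : TGD S X} (hγ : γ ∈ Sig)
    (hns : ¬ (γ.IsFull ∧ γ.IsSideTGD side)) (hR : γ.head.rel ∈ R) {τ : X → V}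
    (hτ : γ.IsTrigger τ T.bag) {D : Set V} (hD : D.Finite) :
    ∃ T' τ', MacroSteps Sig side R T T' ∧ Saturated Sig side R T' ∧
      Set.EqOn τ' τ γ.bodyVars ∧ γ.head.subst τ' ∈ T'.bag ∧
      inheritedFacts side T (γ.head.subst τ') ⊆ T'.bag ∧
      adom T'.bag = (γ.head.subst τ').terms ∧
      (∀ a ∈ adom T'.bag, a ∈ D → a ∈ adom T.bag) ∧
      ∀ F ∈ T'.bag, F.IsSide side → F.terms ⊆ adom T.bag → F ∈ T.bag := by
  obtain ⟨T₁, τ', hstep, heq, ⟨k, hk⟩, hchain, hbag, hfresh⟩ :=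
    h.exists_macroStep_child hγ hns hR hτ hD
  -- The child can be saturated: a return with new facts to one of its proper ancestors would update
  -- the branch of `T`, against its saturation.
  obtain ⟨T', hT', hr, hsat⟩ := hstep.coherent.exists_saturated (Sig := Sig) hRfin
    fun T₂ hT₂ ⟨hsuf, hlt⟩ => by
      rw [hk] at hsuf ⊢
      refine (List.suffix_cons_iff.1 hsuf).resolve_right fun hsuf => ?_
      refine hs T₂ (.head hstep hT₂) ⟨hsuf, ?_⟩
      rwa [hchain _ hsuf] at hlt
  have hTT' : MacroSteps Sig side R T T' := .head hstep hT'
  have hsub : T₁.bag ⊆ T'.bag := by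
    rw [bag, bag, hr]
    exact hT'.facts_subset T₁.recent_mem
  have hadom : adom T'.bag = (γ.head.subst τ').terms := by
    rw [bag, hr, hT'.adom_eq T₁.recent_mem, ← bag, hbag, adom_insert_inheritedFacts]
  refine ⟨T', τ', hTT', hsat, heq, hsub (hbag ▸ Or.inl rfl),
    fun F hF => hsub (hbag ▸ Or.inr hF), hadom, fun a ha => hfresh a (hadom ▸ ha), ?_⟩
  intro F hF hside hterms
  have hsuf : T.recent <:+ T'.recent := by
    rw [hr, hk]
    exact List.suffix_cons _ _
  -- The parent has not changed since `T`, so coherence of `T'` at the parent speaks about the bag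
  -- of `T`.
  have he := hs.facts_eq hTT' (List.suffix_refl _)
  have := (hTT'.coherent h).side_mem _ hsuf F (T'.bag_subset_underlying hF) hside
  rw [he] at this
  exact this hterms

end ChaseTree

/-! ## The model given by saturated trees -/

namespace ChaseTree

variable {side R : Set S.Rel} {Sig : Set (TGD S X)} {T₀ : ChaseTree S V}
  {𝓢 𝓢' : Set (ChaseTree S V)}

/-- A finite family of saturated trees reachable from `T₀`, seen as the family of their bags: each side
fact of a bag belongs to all the bags which guard it. -/
structure BagFamily (Sig : Set (TGD S X)) (side R : Set S.Rel) (T₀ : ChaseTree S V)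
    (𝓢 : Set (ChaseTree S V)) : Prop where
  finite : 𝓢.Finite
  reachable : ∀ T ∈ 𝓢, MacroSteps Sig side R T₀ T
  saturated : ∀ T ∈ 𝓢, Saturated Sig side R T
  side_mem : ∀ T ∈ 𝓢, ∀ T' ∈ 𝓢, ∀ F ∈ T.bag, F.IsSide side → F.terms ⊆ adom T'.bag → F ∈ T'.bag

/-- The head of `γ` has an instance for the trigger `τ` in one of the bags. -/
def Fires (γ : TGD S X) (τ : X → V) (𝓢 : Set (ChaseTree S V)) : Prop :=
  ∃ τ' : X → V, Set.EqOn τ' τ γ.bodyVars ∧ ∃ T ∈ 𝓢, γ.head.subst τ' ∈ T.bag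

lemma Fires.mono {γ : TGD S X} {τ : X → V} (h : Fires γ τ 𝓢) (hs : 𝓢 ⊆ 𝓢') : Fires γ τ 𝓢' :=
  let ⟨τ', he, T, hT, hm⟩ := h
  ⟨τ', he, T, hs hT, hm⟩

lemma Fires.congr {γ : TGD S X} {τ τ₁ : X → V} (h : Fires γ τ 𝓢)
    (he : Set.EqOn τ τ₁ γ.bodyVars) : Fires γ τ₁ 𝓢 :=
  let ⟨τ', he', hT⟩ := h
  ⟨τ', he'.trans he, hT⟩

/-- The new bag meets any other bag only in values of its parent's bag. Comparing side facts thus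
factors through the parent: upwards because the saturated child has nothing new for it, downwards by
inheritance. -/
lemma BagFamily.exists_fires [Infinite V] (hRfin : R.Finite) (hR : ∀ γ ∈ Sig, γ.head.rel ∈ R)
    (h₀ : T₀.Coherent side R) (h : BagFamily Sig side R T₀ 𝓢) {T : ChaseTree S V} (hT : T ∈ 𝓢)
    {γ : TGD S X} (hγ : γ ∈ Sig) {τ : X → V} (hτ : γ.IsTrigger τ T.bag) :
    ∃ 𝓢', 𝓢 ⊆ 𝓢' ∧ BagFamily Sig side R T₀ 𝓢' ∧ Fires γ τ 𝓢' := by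
  have hc := (h.reachable T hT).coherent h₀
  by_cases hs : γ.IsFull ∧ γ.IsSideTGD side
  · exact ⟨𝓢, subset_rfl, h, τ, Set.eqOn_refl _ _, T, hT,
      (h.saturated T hT).head_mem hc hγ hs.1 hs.2 (hR γ hγ) hτ⟩
  have hD : (⋃ T ∈ 𝓢, adom T.bag).Finite := h.finite.biUnion fun T _ => adom_finite T.bag_finite
  obtain ⟨T', τ', hsteps, hsat, heq, hmem, hinh, hadom, hfresh, hback⟩ :=
    (h.saturated T hT).exists_child hRfin hc hγ hs (hR γ hγ) hτ hD
  have hold : ∀ T₁ ∈ 𝓢, ∀ a ∈ adom T'.bag, a ∈ adom T₁.bag → a ∈ adom T.bag :=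
    fun T₁ hT₁ a ha ha₁ => hfresh a ha (Set.mem_biUnion hT₁ ha₁)
  refine ⟨insert T' 𝓢, Set.subset_insert _ _, ?_, τ', heq, T', Or.inl rfl, hmem⟩
  exact {
    finite := h.finite.insert _
    reachable := by
      rintro T₁ (rfl | hT₁)
      exacts [(h.reachable T hT).trans hsteps, h.reachable T₁ hT₁]
    saturated := by
      rintro T₁ (rfl | hT₁)
      exacts [hsat, h.saturated T₁ hT₁]
    side_mem := by
      rintro T₁ (rfl | hT₁) T₂ (rfl | hT₂) F hF hside hterms
      · exact hF
      · exact h.side_mem T hT T₂ hT₂ F (hback F hF hside fun a ha =>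
          hold T₂ hT₂ a (terms_subset_adom hF ha) (hterms ha)) hside hterms
      · exact hinh ⟨h.side_mem T₁ hT₁ T hT F hF hside fun a ha =>
          hold T₁ hT₁ a (hterms ha) (terms_subset_adom hF ha), hside, hadom ▸ hterms⟩
      · exact h.side_mem T₁ hT₁ T₂ hT₂ F hF hside hterms }

/-- There may be infinitely many substitutions, but on the body variables a trigger is determined by
the image of the guard, a fact of the finite bag. It suffices to fire one trigger per tree,
dependency and guard image. -/
lemma BagFamily.exists_fires_all [Infinite V] (hRfin : R.Finite)
    (hR : ∀ γ ∈ Sig, γ.head.rel ∈ R) (hfin : Sig.Finite) (hguarded : ∀ γ ∈ Sig, γ.IsGuarded)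
    (h₀ : T₀.Coherent side R) (h : BagFamily Sig side R T₀ 𝓢) :
    ∃ 𝓢', 𝓢 ⊆ 𝓢' ∧ BagFamily Sig side R T₀ 𝓢' ∧
      ∀ T ∈ 𝓢, ∀ γ ∈ Sig, ∀ τ : X → V, γ.IsTrigger τ T.bag → Fires γ τ 𝓢' := by
  have hex : ∀ γ : TGD S X, ∃ A, γ.IsGuarded → γ.IsGuard A := fun γ => by
    by_cases hγ : γ.IsGuarded
    -- The head is only a default value for unguarded dependencies.
    exacts [⟨hγ.choose, fun _ => hγ.choose_spec⟩, ⟨γ.head, fun h => absurd h hγ⟩]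
  choose g hg using hex
  have key : ∀ D : Set (ChaseTree S V × TGD S X × GroundFact S V), D.Finite →
      (∀ d ∈ D, d.1 ∈ 𝓢 ∧ d.2.1 ∈ Sig) → ∃ 𝓢', 𝓢 ⊆ 𝓢' ∧ BagFamily Sig side R T₀ 𝓢' ∧
      ∀ d ∈ D, ∀ τ : X → V, d.2.1.IsTrigger τ d.1.bag → (g d.2.1).subst τ = d.2.2 →
        Fires d.2.1 τ 𝓢' := by
    intro D hD
    induction D, hD using Set.Finite.induction_on with
    | empty => exact fun _ => ⟨𝓢, subset_rfl, h, fun d hd => absurd hd (Set.notMem_empty d)⟩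
    | @insert d D _ _ ih =>
      intro hsub
      obtain ⟨𝓢₁, hs₁, h₁, hf₁⟩ := ih fun d hd => hsub d (Or.inr hd)
      have hd := hsub d (Or.inl rfl)
      by_cases hτ : ∃ τ : X → V, d.2.1.IsTrigger τ d.1.bag ∧ (g d.2.1).subst τ = d.2.2
      · obtain ⟨τ, hτ, he⟩ := hτ
        obtain ⟨𝓢₂, hs₂, h₂, hf₂⟩ := h₁.exists_fires hRfin hR h₀ (hs₁ hd.1) hd.2 hτ
        refine ⟨𝓢₂, hs₁.trans hs₂, h₂, ?_⟩
        rintro d' (rfl | hd') τ' hτ' he'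
        · exact hf₂.congr fun x hx => eqOn_of_subst_eq (he.trans he'.symm)
            ((hg _ (hguarded _ hd.2)).2 hx)
        · exact (hf₁ d' hd' τ' hτ' he').mono hs₂
      · refine ⟨𝓢₁, hs₁, h₁, ?_⟩
        rintro d' (rfl | hd') τ' hτ' he'
        · exact absurd ⟨τ', hτ', he'⟩ hτ
        · exact hf₁ d' hd' τ' hτ' he'
  obtain ⟨𝓢', hs, h', hf⟩ := key (𝓢 ×ˢ Sig ×ˢ ⋃ T ∈ 𝓢, T.bag)
    (h.finite.prod (hfin.prod (h.finite.biUnion fun T _ => T.bag_finite)))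
    fun d hd => ⟨hd.1, hd.2.1⟩
  refine ⟨𝓢', hs, h', fun T hT γ hγ τ hτ => hf (T, γ, (g γ).subst τ) ⟨hT, hγ, ?_⟩ τ hτ rfl⟩
  exact Set.mem_biUnion hT (hτ _ (hg γ (hguarded γ hγ)).1)

/-- The union of the bags of some saturated reachable trees is a model. -/
lemma exists_model [Infinite V] (hRfin : R.Finite) (hR : ∀ γ ∈ Sig, γ.head.rel ∈ R)
    (hfin : Sig.Finite) (hobeys : ∀ γ ∈ Sig, γ.Obeys side) (h₀ : T₀.Coherent side R)
    (h : BagFamily Sig side R T₀ 𝓢) :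
    ∃ J : RelInstance S V, (∀ T ∈ 𝓢, T.bag ⊆ J) ∧ (∀ γ ∈ Sig, γ.SatisfiedBy J) ∧
      ∀ F ∈ J, ∃ T, MacroSteps Sig side R T₀ T ∧ F ∈ T.bag := by
  have hguarded : ∀ γ ∈ Sig, γ.IsGuarded := fun γ hγ =>
    let ⟨A, hA, _⟩ := hobeys γ hγ
    ⟨A, hA⟩
  have hnext : ∀ 𝓕 : {𝓕 : Set (ChaseTree S V) // BagFamily Sig side R T₀ 𝓕},
      ∃ 𝓖 : {𝓕 : Set (ChaseTree S V) // BagFamily Sig side R T₀ 𝓕}, 𝓕.1 ⊆ 𝓖.1 ∧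
        ∀ T ∈ 𝓕.1, ∀ γ ∈ Sig, ∀ τ : X → V, γ.IsTrigger τ T.bag → Fires γ τ 𝓖.1 := fun 𝓕 =>
    let ⟨𝓖, hs, h𝓖, hf⟩ := 𝓕.2.exists_fires_all hRfin hR hfin hguarded h₀
    ⟨⟨𝓖, h𝓖⟩, hs, hf⟩
  choose next hsub hfires using hnext
  let 𝓕 : ℕ → {𝓕 : Set (ChaseTree S V) // BagFamily Sig side R T₀ 𝓕} :=
    fun n => Nat.rec ⟨𝓢, h⟩ (fun _ => next) n
  have hmono : Monotone fun n => (𝓕 n).1 := monotone_nat_of_le_succ fun n => hsub (𝓕 n)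
  refine ⟨{F | ∃ n, ∃ T ∈ (𝓕 n).1, F ∈ T.bag}, fun T hT F hF => ⟨0, T, hT, hF⟩, ?_,
    fun F ⟨n, T, hT, hF⟩ => ⟨T, (𝓕 n).2.reachable T hT, hF⟩⟩
  rintro γ hγ ⟨τ, hτ, hnot⟩
  obtain ⟨A, hA, hside⟩ := hobeys γ hγ
  obtain ⟨n, T, hT, hAT⟩ := hτ A hA.1
  -- The whole trigger moves into the bag of the guard: at stage `max m n` both trees belong to one
  -- family, and the other body atoms become side facts over values of the guard's image.
  have hτT : γ.IsTrigger τ T.bag := by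
    intro B hB
    by_cases hBA : B = A
    · rwa [hBA]
    obtain ⟨m, T', hT', hBT'⟩ := hτ B hB
    refine (𝓕 (max m n)).2.side_mem T' (hmono (le_max_left m n) hT') T
      (hmono (le_max_right m n) hT) _ hBT' (hside B hB hBA) fun a ha => ?_
    obtain ⟨x, hx, rfl⟩ := mem_terms_subst.1 ha
    exact terms_subset_adom hAT (mem_terms_subst.2 ⟨x, hA.2 ⟨B, hB, hx⟩, rfl⟩)
  obtain ⟨τ', he, T', hT', hm⟩ := hfires (𝓕 n) T hT γ hγ τ hτT
  exact hnot ⟨τ', he, n + 1, T', hT', hm⟩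

/-! ## From reachability to chase sequences -/

lemma ExemptStep.relaxedStep {T T' : ChaseTree S V} (h : ExemptStep Sig side T T') :
    RelaxedStep Sig T T' := by
  rcases h with ⟨k, p, F, -, -, h⟩ | ⟨-, γ, hγ, τ, ⟨-, h⟩ | ⟨H, -, h | ⟨-, h⟩⟩⟩
  · exact Or.inr ⟨_, _, _, h⟩
  · exact Or.inl ⟨γ, hγ, τ, _, Or.inl h⟩
  · exact Or.inl ⟨γ, hγ, τ, _, Or.inr ⟨H, Or.inl h⟩⟩
  · exact Or.inl ⟨γ, hγ, τ, _, Or.inr ⟨H, Or.inr h⟩⟩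

end ChaseTree

lemma exists_fin_chain_of_reflTransGen {α : Type*} {r : α → α → Prop} {a b : α}
    (h : Relation.ReflTransGen r a b) :
    ∃ (n : ℕ) (f : Fin (n + 1) → α), f 0 = a ∧ f (Fin.last n) = b ∧
      ∀ i : Fin n, r (f i.castSucc) (f i.succ) := by
  induction h with
  | refl => exact ⟨0, fun _ => a, rfl, rfl, fun i => i.elim0⟩
  | @tail b c _ hbc ih =>
    obtain ⟨n, f, h₀, hl, hs⟩ := ih
    refine ⟨n + 1, Fin.snoc (α := fun _ => α) f c, ?_, Fin.snoc_last .., fun i => ?_⟩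
    · rw [← Fin.castSucc_zero, Fin.snoc_castSucc, h₀]
    · induction i using Fin.lastCases with
      | last => rwa [Fin.snoc_castSucc, Fin.succ_last, Fin.snoc_last, hl]
      | cast i => rw [Fin.snoc_castSucc, Fin.succ_castSucc, Fin.snoc_castSucc]; exact hs i

lemma exists_isPrincipalExemptProof {side : Set S.Rel} {Sig : Set (TGD S X)} {I : RelInstance S V}
    {T₀ T : ChaseTree S V} (h₀ : T₀.IsInitial I)
    (h : Relation.ReflTransGen (ChaseTree.ExemptStep Sig side) T₀ T) {F : GroundFact S V}
    (hF : F ∈ T.bag) :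
    ∃ (n : ℕ) (f : Fin (n + 1) → ChaseTree S V), IsPrincipalExemptProof Sig side I F n f := by
  obtain ⟨n, f, hf₀, hl, hs⟩ := exists_fin_chain_of_reflTransGen h
  exact ⟨n, f, ⟨⟨hf₀ ▸ h₀, fun i => (hs i).relaxedStep⟩, hs⟩,
    T.recent, hl ▸ T.recent_mem, hl ▸ hF⟩

end GTGDChase

/-! ### Completeness of the principal-exempt one-pass chase -/

theorem mainTheorem5 {S : RelSignature} {X V : Type*} [Infinite V]
    (side : Set S.Rel)
    (I₀ : RelInstance S V) (hI₀ : I₀.Finite)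
    (Sig : Set (TGD S X)) (hfin : Sig.Finite)
    (hguarded : ∀ γ ∈ Sig, γ.IsGuarded) (hobeys : ∀ γ ∈ Sig, γ.Obeys side)
    (F : GroundFact S V) (hF : EntailsFact I₀ Sig F) :
    ∃ (n : ℕ) (T : Fin (n + 1) → ChaseTree S V), IsPrincipalExemptProof Sig side I₀ F n T := by
  -- The signature may be infinite, but only relations of `I₀` and of heads ever occur in a chase;
  -- finiteness of `R` bounds the growth of nodes.
  set R : Set S.Rel := (fun G => G.rel) '' I₀ ∪ (fun γ => γ.head.rel) '' Sig
  have hRfin : R.Finite := (hI₀.image _).union (hfin.image _)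
  have hR : ∀ γ ∈ Sig, γ.head.rel ∈ R := fun γ hγ => Or.inr ⟨γ, hγ, rfl⟩
  have h₀ : (ChaseTree.single I₀ hI₀).Coherent side R :=
    ChaseTree.coherent_single hI₀ fun G hG => Or.inl ⟨G, hG, rfl⟩
  -- The branch of the root is the root alone, so the condition on returns is automatic.
  obtain ⟨T, hT, hr, hsat⟩ := h₀.exists_saturated (Sig := Sig) hRfin
    fun T hT hu => List.suffix_nil.1 hu.1
  have hfam : ChaseTree.BagFamily Sig side R (ChaseTree.single I₀ hI₀) {T} := {
    finite := Set.finite_singleton T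
    reachable := by rintro _ rfl; exact hT
    saturated := by rintro _ rfl; exact hsat
    side_mem := by rintro _ rfl _ rfl G hG _ _; exact hG }
  obtain ⟨J, hJ, hmodel, hreach⟩ := ChaseTree.exists_model hRfin hR hfin hobeys h₀ hfam
  have hI : I₀ ⊆ J := by
    refine Set.Subset.trans ?_ (hJ T rfl)
    rw [ChaseTree.bag, hr]
    exact hT.facts_subset (ChaseTree.recent_mem _)
  obtain ⟨T', hT', hF'⟩ := hreach F (hF J hI hmodel)
  exact exists_isPrincipalExemptProof ⟨rfl, rfl, rfl⟩ hT'.steps hF'
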